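/- Fix $N\in\mathbb{N}$. For every $T>0$ let $H_T:[0,1]\to\mathbb{C}^{N\times N}$ be a Hermitian-matrix-valued function (a Hamiltonian in the dimensionless time $s=t/T$) that is twice differentiable on $[0,1]$, and let $U_T(s,0)$ be its time-evolution operator, i.e. the solution on $[0,1]$ of $i\,\partial_sU_T(s,0)=T\,H_T(s)\,U_T(s,0)$ with $U_T(0,0)=\mathbb{1}$. Let $G_T(s)$, $s\in[0,1]$, be normalized eigenvectors of $H_T(s)$ belonging to a continuous eigenvalue $E_T(s)$ that is non-degenerate (has a one-dimensional eigenspace) for every $s\in[0,1]$, and put $P_{G_T}(1)=|G_T(1)\rangle\langle G_T(1)|$. Let $\gamma_{\min}(T)$ be the infimum of $|\lambda-\mu|$ over all $s\in[0,1]$ and all pairs of distinct eigenvalues $\lambda\neq\mu$ of $H_T(s)$ (with $\gamma_{\min}(T)=\infty$ if there is no such pair), and let $\|\dot H_T\|$ and $\|\ddot H_T\|$ be the suprema over $s\in[0,1]$ of the operator norms of $\dot H_T(s)$ and $\ddot H_T(s)$. If $\|\dot H_T\|$ and $\gamma_{\min}(T)^{-1}$ are bounded above by constants independent of $T$ for all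 $T>0$ (in particular $\gamma_{\min}(T)>0$), and $\|\ddot H_T\|\in o(T)$ as $T\to\infty$, then $$\lim_{T\to\infty}\bigl\|(\mathbb{1}-P_{G_T}(1))\,U_T(1,0)\,G_T(0)\bigr\|=0 .$$ -/

import Mathlib

open Set Filter Topology
open scoped ENNReal NNReal Matrix.Norms.L2Operator

noncomputable section

namespace Adiabatic

/-- Complex `N × N` matrices, normed by the operator norm of the Euclidean norm on `ℂ^N`. -/
abbrev Mat (N : ℕ) := Matrix (Fin N) (Fin N) ℂ

/-- The state space `ℂ^N` with its Euclidean norm. -/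
abbrev State (N : ℕ) := EuclideanSpace ℂ (Fin N)

/-- The first derivative of a matrix-valued function on `[0,1]` (one-sided at the end points). -/
def dot {N : ℕ} (H : ℝ → Mat N) : ℝ → Mat N :=
  derivWithin H (Icc 0 1)

/-- `H` is twice differentiable on `[0,1]` (one-sided at the end points); the second derivative
need not be continuous. -/
def TwiceDifferentiable {N : ℕ} (H : ℝ → Mat N) : Prop :=
  DifferentiableOn ℝ H (Icc 0 1) ∧ DifferentiableOn ℝ (dot H) (Icc 0 1)

/-- The supremum over `s ∈ [0,1]` of the operator norm of `A s`, possibly `∞`. -/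
def supNorm {N : ℕ} (A : ℝ → Mat N) : ℝ≥0∞ :=
  ⨆ s ∈ Icc (0 : ℝ) 1, ‖A s‖ₑ

/-- The minimum eigenvalue gap of `H` on `[0,1]`: the infimum of `|E - E'|` over all `s ∈ [0,1]`
and all pairs of distinct eigenvalues `E ≠ E'` of `H s`. It is `∞` if there are no such pairs. -/
def gapMin {N : ℕ} (H : ℝ → Mat N) : ℝ≥0∞ :=
  ⨅ s ∈ Icc (0 : ℝ) 1, (spectrum ℂ (H s)).einfsep

/-- `G s` is a normalized eigenvector of `H s` for an eigenvalue `E s` that is non-degenerate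
(its eigenspace is a line) for every `s ∈ [0,1]` and that follows a continuous energy level.
The phase of `G s` is arbitrary. -/
structure IsNondegenerateEigenstate {N : ℕ} (H : ℝ → Mat N) (E : ℝ → ℝ) (G : ℝ → State N) :
    Prop where
  continuousOn_energy : ContinuousOn E (Icc 0 1)
  norm_eq_one : ∀ s ∈ Icc (0 : ℝ) 1, ‖G s‖ = 1
  eigenvector : ∀ s ∈ Icc (0 : ℝ) 1, Matrix.toEuclideanLin (H s) (G s) = (E s : ℂ) • G s
  nondegenerate : ∀ s ∈ Icc (0 : ℝ) 1,
    Module.finrank ℂ (Module.End.eigenspace (Matrix.toEuclideanLin (H s)) (E s : ℂ)) = 1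

/-- `U s` is the time-evolution operator `U(s,0)` in the dimensionless time `s = t / T`, for total
evolution time `T` (units with `ħ = 1`): the solution on `[0,1]` of the Schrödinger equation
`i U' = T H U` with `U 0 = 1`. -/
structure IsEvolution {N : ℕ} (T : ℝ) (H U : ℝ → Mat N) : Prop where
  initial : U 0 = 1
  schrodinger : ∀ s ∈ Icc (0 : ℝ) 1,
    HasDerivWithinAt U ((-(Complex.I * (T : ℂ))) • (H s * U s)) (Icc 0 1) s

/-- The projector `|v⟩⟨v|`. -/
def proj {N : ℕ} (v : State N) : Mat N :=
  Matrix.of fun i j => v i * star (v j)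

/-- The error in the adiabatic approximation, `‖(1 - P_G(1)) U(1,0) |G(0)⟩‖`. -/
def adiabaticError {N : ℕ} (G : ℝ → State N) (U : ℝ → Mat N) : ℝ :=
  ‖Matrix.toEuclideanLin ((1 - proj (G 1)) * U 1) (G 0)‖

end Adiabatic

end

/-! Let `p` be the spectral projection onto the energy level, `s = r - p` the reduced resolvent,
`h'` and `h''` the derivatives of the Hamiltonian `h`. The operator `x = p h' s² - s² h' p`
(`correction`) solves `[h, x] = p'`. Hence for `y = p + (i/T) x` the terms of order one cancel in
the Heisenberg equation, which leaves `(U* y U)' = (i/T) U* x' U`. So `U* p U` moves by at most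
`O((‖x‖ + ‖x'‖)/T)` on `[0,1]`, and this controls `(1 - p(1)) U(1) p(0)`.

The gap bounds `r`, hence `p'`, `r'` and `x`. Only `x'` contains `h''`, and linearly, so the error
is at most `(M₁ + M₂ ‖h''‖)/T`, which tends to zero if `‖h''‖ = o(T)`. A mean value inequality
replaces integration, so `h''` need not be continuous.

The smoothness of `p` and of the eigenvalue comes from exact perturbation identities
(`proj_sub_proj`, `eigenvalue_sub_smul`) rather than contour integrals. -/

namespace Adiabatic

/-- `p` is an idempotent spectral projection of `h` for the eigenvalue `e`, and `r` is the inverse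
of `h - e + p`, so that `r - p` is the reduced resolvent of `h` at `e`. -/
structure IsSpectralProjection {𝔸 : Type*} [Ring 𝔸] [Algebra ℂ 𝔸] (h : 𝔸) (e : ℂ) (p r : 𝔸) :
    Prop where
  idem : p * p = p
  left : h * p = e • p
  right : p * h = e • p
  inv_mul : r * (h - e • 1 + p) = 1
  mul_inv : (h - e • 1 + p) * r = 1

namespace IsSpectralProjection

/-! ### Algebra of the reduced resolvent. -/

section Algebra

variable {𝔸 : Type*} [Ring 𝔸] [Algebra ℂ 𝔸] {h h₀ p p₀ r r₀ : 𝔸} {e e₀ : ℂ}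

lemma inv_mul_proj (hp : IsSpectralProjection h e p r) : r * p = p := by
  have h1 : (h - e • 1 + p) * p = p := by
    simp [add_mul, sub_mul, hp.left, hp.idem]
  calc r * p = r * ((h - e • 1 + p) * p) := by rw [h1]
    _ = p := by rw [← mul_assoc, hp.inv_mul, one_mul]

lemma proj_mul_inv (hp : IsSpectralProjection h e p r) : p * r = p := by
  have h1 : p * (h - e • 1 + p) = p := by
    simp [mul_add, mul_sub, hp.right, hp.idem]
  calc p * r = p * (h - e • 1 + p) * r := by rw [h1]
    _ = p := by rw [mul_assoc, hp.mul_inv, mul_one]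

lemma reduced_mul_proj (hp : IsSpectralProjection h e p r) : (r - p) * p = 0 := by
  rw [sub_mul, hp.inv_mul_proj, hp.idem, sub_self]

lemma proj_mul_reduced (hp : IsSpectralProjection h e p r) : p * (r - p) = 0 := by
  rw [mul_sub, hp.proj_mul_inv, hp.idem, sub_self]

lemma reduced_mul_sub (hp : IsSpectralProjection h e p r) :
    (r - p) * (h - e • 1) = 1 - p := by
  have h1 : p * (h - e • 1) = 0 := by simp [mul_sub, hp.right]
  have h2 := hp.inv_mul
  rw [mul_add, hp.inv_mul_proj] at h2
  rw [sub_mul, h1, sub_zero, eq_sub_iff_add_eq, h2]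

lemma sub_mul_reduced (hp : IsSpectralProjection h e p r) :
    (h - e • 1) * (r - p) = 1 - p := by
  have h1 : (h - e • 1) * p = 0 := by simp [sub_mul, hp.left]
  have h2 := hp.mul_inv
  rw [add_mul, hp.proj_mul_inv] at h2
  rw [mul_sub, h1, sub_zero, eq_sub_iff_add_eq, h2]

/-- First-order perturbation of the projection, as an exact identity. -/
lemma proj_sub_proj (hp : IsSpectralProjection h e p r) (hp₀ : IsSpectralProjection h₀ e₀ p₀ r₀) :
    p - p₀ = (r₀ - p₀) * ((e - e₀) • 1 - (h - h₀)) * p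
      - p₀ * ((h - h₀) - (e - e₀) • 1) * (r - p) := by
  have a1 : ((e - e₀) • 1 - (h - h₀)) * p = (h₀ - e₀ • 1) * p := by
    simp only [sub_mul, hp.left, sub_smul, smul_mul_assoc, one_mul]; abel
  have a2 : p₀ * ((h - h₀) - (e - e₀) • 1) = p₀ * (h - e • 1) := by
    simp only [mul_sub, hp₀.right, sub_smul, mul_smul_comm, mul_one]; abel
  rw [mul_assoc, a1, a2, ← mul_assoc, hp₀.reduced_mul_sub, mul_assoc, hp.sub_mul_reduced]
  noncomm_ring

/-- First-order perturbation of the eigenvalue, as an exact identity. -/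
lemma eigenvalue_sub_smul (hp : IsSpectralProjection h e p r)
    (hp₀ : IsSpectralProjection h₀ e₀ p₀ r₀) :
    (e - e₀) • (p₀ * p) = p₀ * (h - h₀) * p := by
  simp only [mul_sub, sub_mul, hp₀.right, mul_assoc, hp.left, sub_smul, smul_mul_assoc,
    mul_smul_comm]

/-- The commutator equation solved by the first-order adiabatic correction. -/
lemma commutator_correction (hp : IsSpectralProjection h e p r) (d : 𝔸) :
    h * (p * d * ((r - p) * (r - p)) - (r - p) * (r - p) * d * p)
      - (p * d * ((r - p) * (r - p)) - (r - p) * (r - p) * d * p) * h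
      = -((r - p) * d * p) - p * d * (r - p) := by
  have e1 := hp.reduced_mul_sub
  have e2 := hp.sub_mul_reduced
  have z1 := hp.reduced_mul_proj
  have z2 := hp.proj_mul_reduced
  generalize r - p = s at *
  have l1 : h * s = e • s + (1 - p) := by
    rw [sub_mul, smul_mul_assoc, one_mul, sub_eq_iff_eq_add] at e2; rw [e2]; abel
  have l2 : s * h = e • s + (1 - p) := by
    rw [mul_sub, mul_smul_comm, mul_one, sub_eq_iff_eq_add] at e1; rw [e1]; abel
  have t1 : h * (p * d * (s * s)) = e • (p * d * (s * s)) := by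
    simp only [← mul_assoc, hp.left, smul_mul_assoc]
  have t2 : h * (s * s * d * p) = e • (s * s * d * p) + s * d * p := by
    simp only [← mul_assoc, l1, add_mul, smul_mul_assoc, sub_mul, z2, one_mul, sub_zero]
  have t3 : p * d * (s * s) * h = e • (p * d * (s * s)) + p * d * s := by
    simp only [mul_assoc, l2, mul_add, mul_smul_comm, mul_sub, z1, mul_one, sub_zero]
  have t4 : s * s * d * p * h = e • (s * s * d * p) := by
    simp only [mul_assoc, hp.right, mul_smul_comm]
  rw [mul_sub, sub_mul, t1, t2, t3, t4]
  abel

end Algebra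

/-! ### Regularity of the eigenvalue, the projection and the resolvent. -/

section Regularity

variable {𝔸 : Type*} [NormedRing 𝔸] [NormedAlgebra ℂ 𝔸]
  {h p r : ℝ → 𝔸} {e : ℝ → ℂ} {I : Set ℝ} {c : ℝ}

/-- The exact identity for `p s - p a` is linear in the increments of `h` and `e`. A uniform bound
on `r` suffices, so continuity of `r` can be deduced afterwards. -/
lemma continuousOn_proj (hp : ∀ s ∈ I, IsSpectralProjection (h s) (e s) (p s) (r s))
    (hh : ContinuousOn h I) (he : ContinuousOn e I) (hpn : ∀ s ∈ I, ‖p s‖ ≤ 1)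
    (hrn : ∀ s ∈ I, ‖r s‖ ≤ c) : ContinuousOn p I := by
  intro a ha
  have hsn : ∀ s ∈ I, ‖r s - p s‖ ≤ c + 1 := fun s hs =>
    (norm_sub_le _ _).trans (add_le_add (hrn s hs) (hpn s hs))
  have hc : 0 ≤ c + 1 := (norm_nonneg _).trans (hsn a ha)
  have lim0 : Tendsto (fun s => (e s - e a) • (1 : 𝔸) - (h s - h a)) (𝓝[I] a) (𝓝 0) := by
    have h1 : Tendsto (fun s => (e s - e a) • (1 : 𝔸) - (h s - h a)) (𝓝[I] a)
        (𝓝 ((e a - e a) • (1 : 𝔸) - (h a - h a))) :=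
      (((he a ha).tendsto.sub_const _).smul_const _).sub ((hh a ha).tendsto.sub_const _)
    simpa using h1
  have lim1 : Tendsto (fun s => 2 * (c + 1) * ‖(e s - e a) • (1 : 𝔸) - (h s - h a)‖) (𝓝[I] a)
      (𝓝 0) := by simpa using lim0.norm.const_mul (2 * (c + 1))
  refine tendsto_iff_norm_sub_tendsto_zero.2
    (squeeze_zero' (Eventually.of_forall fun _ => norm_nonneg _) ?_ lim1)
  filter_upwards [self_mem_nhdsWithin] with s hs
  rw [(hp s hs).proj_sub_proj (hp a ha), ← neg_sub ((e s - e a) • (1 : 𝔸)) (h s - h a)]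
  set x := (e s - e a) • (1 : 𝔸) - (h s - h a)
  calc ‖(r a - p a) * x * p s - p a * -x * (r s - p s)‖
      ≤ ‖r a - p a‖ * ‖x‖ * ‖p s‖ + ‖p a‖ * ‖-x‖ * ‖r s - p s‖ :=
        (norm_sub_le _ _).trans (add_le_add (norm_mul₃_le) (norm_mul₃_le))
    _ ≤ (c + 1) * ‖x‖ * 1 + 1 * ‖x‖ * (c + 1) := by
        rw [norm_neg]
        gcongr
        exacts [hsn a ha, hpn s hs, hpn a ha, hsn s hs]
    _ = 2 * (c + 1) * ‖x‖ := by ring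

lemma eq_ringInverse {h p r : 𝔸} {e : ℂ} (hp : IsSpectralProjection h e p r) :
    ∃ u : 𝔸ˣ, (u : 𝔸) = h - e • 1 + p ∧ (↑u⁻¹ : 𝔸) = r ∧ Ring.inverse (h - e • 1 + p) = r :=
  ⟨⟨h - e • 1 + p, r, hp.mul_inv, hp.inv_mul⟩, rfl, rfl,
    Ring.inverse_unit (⟨h - e • 1 + p, r, hp.mul_inv, hp.inv_mul⟩ : 𝔸ˣ)⟩

lemma continuousOn_inv [CompleteSpace 𝔸]
    (hp : ∀ s ∈ I, IsSpectralProjection (h s) (e s) (p s) (r s))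
    (hh : ContinuousOn h I) (he : ContinuousOn e I) (hpc : ContinuousOn p I) :
    ContinuousOn r I := by
  have hk : ContinuousOn (fun s => h s - e s • (1 : 𝔸) + p s) I :=
    (hh.sub (he.smul continuousOn_const)).add hpc
  have : ContinuousOn (fun s => Ring.inverse (h s - e s • (1 : 𝔸) + p s)) I := by
    intro a ha
    obtain ⟨u, hu, -, -⟩ := (hp a ha).eq_ringInverse
    refine ContinuousAt.comp_continuousWithinAt (g := Ring.inverse) ?_ (hk a ha)
    rw [← hu]
    exact NormedRing.inverse_continuousAt u
  refine this.congr fun s hs => ?_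
  obtain ⟨u, -, -, h3⟩ := (hp s hs).eq_ringInverse
  exact h3.symm

lemma hasDerivWithinAt_eigenvalue
    (hp : ∀ s ∈ I, IsSpectralProjection (h s) (e s) (p s) (r s)) (hpc : ContinuousOn p I)
    {a : ℝ} (ha : a ∈ I) {h' : 𝔸} (hh : HasDerivWithinAt h h' I a) (hpa : p a ≠ 0)
    (hpn : ‖p a‖ ≤ 1) : ∃ e' : ℂ, HasDerivWithinAt e e' I a ∧ ‖e'‖ ≤ ‖h'‖ := by
  -- A norming functional of `p a` turns `(e s - e a) • (p a * p s) = p a * (h s - h a) * p s` into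
  -- a scalar equation. The coefficient `φ (p a * p s)` tends to `‖p a‖ ≠ 0`, so division is allowed
  -- near `a`.
  obtain ⟨φ, hφ1, hφ⟩ := exists_dual_vector ℂ (p a) (norm_ne_zero_iff.2 hpa)
  have hφ0 : φ (p a) ≠ 0 := by simpa [hφ] using hpa
  have hpt : Tendsto p (𝓝[I \ {a}] a) (𝓝 (p a)) :=
    (hpc a ha).tendsto.mono_left (nhdsWithin_mono _ sdiff_subset)
  have hst := hasDerivWithinAt_iff_tendsto_slope.1 hh
  have hden : Tendsto (fun s => φ (p a * p s)) (𝓝[I \ {a}] a) (𝓝 (φ (p a))) := by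
    have := (φ.continuous.tendsto _).comp (hpt.const_mul (p a))
    rwa [(hp a ha).idem] at this
  have hnum : Tendsto (fun s => φ (p a * slope h a s * p s)) (𝓝[I \ {a}] a)
      (𝓝 (φ (p a * h' * p a))) :=
    (φ.continuous.tendsto _).comp ((hst.const_mul (p a)).mul hpt)
  have key : ∀ s ∈ I, (slope e a s) • (p a * p s) = p a * slope h a s * p s := by
    intro s hs
    simp only [slope_def_module]
    rw [mul_smul_comm, smul_mul_assoc, ← (hp s hs).eigenvalue_sub_smul (hp a ha), smul_assoc]
  have hE : HasDerivWithinAt e (φ (p a * h' * p a) / φ (p a)) I a := by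
    rw [hasDerivWithinAt_iff_tendsto_slope]
    refine (hnum.div hden hφ0).congr' ?_
    filter_upwards [self_mem_nhdsWithin, hden.eventually_ne hφ0] with s hs hne
    rw [Pi.div_apply, ← key s hs.1, map_smul, smul_eq_mul, mul_div_cancel_right₀ _ hne]
  refine ⟨_, hE, ?_⟩
  have hpos : 0 < ‖p a‖ := norm_pos_iff.2 hpa
  rw [norm_div, hφ, RCLike.norm_ofReal, abs_norm, div_le_iff₀ hpos]
  calc ‖φ (p a * h' * p a)‖ ≤ ‖φ‖ * ‖p a * h' * p a‖ := φ.le_opNorm _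
    _ ≤ 1 * (‖p a‖ * ‖h'‖ * ‖p a‖) := by rw [hφ1]; gcongr; exact norm_mul₃_le
    _ ≤ 1 * (1 * ‖h'‖ * ‖p a‖) := by gcongr
    _ = ‖h'‖ * ‖p a‖ := by ring

lemma hasDerivWithinAt_proj
    (hp : ∀ s ∈ I, IsSpectralProjection (h s) (e s) (p s) (r s)) (hpc : ContinuousOn p I)
    (hrc : ContinuousOn r I) {a : ℝ} (ha : a ∈ I) {h' : 𝔸} {e' : ℂ}
    (hh : HasDerivWithinAt h h' I a) (he : HasDerivWithinAt e e' I a) :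
    HasDerivWithinAt p (-((r a - p a) * h' * p a) - p a * h' * (r a - p a)) I a := by
  have hpt : Tendsto p (𝓝[I \ {a}] a) (𝓝 (p a)) :=
    (hpc a ha).tendsto.mono_left (nhdsWithin_mono _ sdiff_subset)
  have hrt : Tendsto r (𝓝[I \ {a}] a) (𝓝 (r a)) :=
    (hrc a ha).tendsto.mono_left (nhdsWithin_mono _ sdiff_subset)
  have hst := hasDerivWithinAt_iff_tendsto_slope.1 hh
  have het := (hasDerivWithinAt_iff_tendsto_slope.1 he).smul_const (1 : 𝔸)
  -- The `e'` terms drop out because the reduced resolvent annihilates `p` on both sides.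
  have hval : -((r a - p a) * h' * p a) - p a * h' * (r a - p a)
      = (r a - p a) * (e' • 1 - h') * p a - p a * (h' - e' • 1) * (r a - p a) := by
    simp only [mul_sub, sub_mul, mul_smul_comm, smul_mul_assoc, mul_one, (hp a ha).idem,
      (hp a ha).inv_mul_proj, (hp a ha).proj_mul_inv, mul_assoc, sub_self, smul_zero]
    simp only [← mul_assoc]
    abel
  rw [hasDerivWithinAt_iff_tendsto_slope, hval]
  refine ((((het.sub hst).const_mul _).mul hpt).sub
    (((hst.sub het).const_mul _).mul (hrt.sub hpt))).congr' ?_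
  filter_upwards [self_mem_nhdsWithin] with s hs
  simp only [slope_def_module]
  rw [(hp s hs.1).proj_sub_proj (hp a ha), smul_sub]
  simp only [smul_assoc, ← smul_sub, mul_smul_comm, smul_mul_assoc]

lemma hasDerivWithinAt_inv [CompleteSpace 𝔸]
    (hp : ∀ s ∈ I, IsSpectralProjection (h s) (e s) (p s) (r s)) {a : ℝ} (ha : a ∈ I)
    {h' p' : 𝔸} {e' : ℂ} (hh : HasDerivWithinAt h h' I a) (he : HasDerivWithinAt e e' I a)
    (hp' : HasDerivWithinAt p p' I a) :
    HasDerivWithinAt r (-(r a * (h' - e' • 1 + p') * r a)) I a := by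
  have hk : HasDerivWithinAt (fun s => h s - e s • (1 : 𝔸) + p s) (h' - e' • 1 + p') I a :=
    (hh.sub (he.smul_const (1 : 𝔸))).add hp'
  obtain ⟨u, hu, hu', -⟩ := (hp a ha).eq_ringInverse
  have hinv := hasFDerivAt_ringInverse (𝕜 := ℝ) u
  rw [hu] at hinv
  have := hinv.comp_hasDerivWithinAt a hk
  simp only [hu', neg_apply, ContinuousLinearMap.mulLeftRight_apply] at this
  refine this.congr (fun s hs => ?_) ?_
  · obtain ⟨u, -, -, h3⟩ := (hp s hs).eq_ringInverse
    exact h3.symm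
  · obtain ⟨u, -, -, h3⟩ := (hp a ha).eq_ringInverse
    exact h3.symm

end Regularity

end IsSpectralProjection


lemma norm_mul₃_le_of_le {𝔸 : Type*} [NormedRing 𝔸] {a b c : 𝔸} {x y z : ℝ}
    (ha : ‖a‖ ≤ x) (hb : ‖b‖ ≤ y) (hc : ‖c‖ ≤ z) : ‖a * b * c‖ ≤ x * y * z :=
  norm_mul_le_of_le (norm_mul_le_of_le ha hb) hc

lemma norm_one_le {𝔸 : Type*} [CStarAlgebra 𝔸] : ‖(1 : 𝔸)‖ ≤ 1 := by
  rcases subsingleton_or_nontrivial 𝔸 with h | h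
  · simp [Subsingleton.elim (1 : 𝔸) 0]
  · exact CStarRing.norm_one.le

/-! ### Bounds on the first-order correction. -/

section Correction

variable {𝔸 : Type*} [NormedRing 𝔸]

/-- The first-order adiabatic correction to a spectral projection `p` with reduced resolvent `s`,
where `d` is the derivative of the Hamiltonian. -/
def correction (p s d : 𝔸) : 𝔸 := p * d * (s * s) - s * s * d * p

lemma norm_correction_le {p s d : 𝔸} {σ C : ℝ} (hp : ‖p‖ ≤ 1) (hs : ‖s‖ ≤ σ) (hd : ‖d‖ ≤ C) :
    ‖correction p s d‖ ≤ 2 * (C * σ ^ 2) := by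
  have hss : ‖s * s‖ ≤ σ * σ := norm_mul_le_of_le hs hs
  calc ‖correction p s d‖ ≤ 1 * C * (σ * σ) + σ * σ * C * 1 :=
        norm_sub_le_of_le (norm_mul₃_le_of_le hp hd hss) (norm_mul₃_le_of_le hss hd hp)
    _ = 2 * (C * σ ^ 2) := by ring

lemma exists_hasDerivWithinAt_correction [NormedAlgebra ℂ 𝔸] {I : Set ℝ} {a : ℝ}
    {p s d : ℝ → 𝔸} {p' s' d' : 𝔸} {σ C π τ B : ℝ}
    (hp : HasDerivWithinAt p p' I a) (hs : HasDerivWithinAt s s' I a)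
    (hd : HasDerivWithinAt d d' I a) (np : ‖p a‖ ≤ 1) (ns : ‖s a‖ ≤ σ) (nd : ‖d a‖ ≤ C)
    (np' : ‖p'‖ ≤ π) (ns' : ‖s'‖ ≤ τ) (nd' : ‖d'‖ ≤ B) :
    ∃ x' : 𝔸, HasDerivWithinAt (fun t => correction (p t) (s t) (d t)) x' I a ∧
      ‖x'‖ ≤ 2 * (π * C * σ ^ 2 + 2 * C * τ * σ) + 2 * σ ^ 2 * B := by
  have hss := hs.mul hs
  refine ⟨_, ((hp.mul hd).mul hss).sub ((hss.mul hd).mul hp), ?_⟩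
  have nss : ‖(s * s) a‖ ≤ σ * σ := norm_mul_le_of_le ns ns
  have nss' : ‖s' * s a + s a * s'‖ ≤ τ * σ + σ * τ :=
    norm_add_le_of_le (norm_mul_le_of_le ns' ns) (norm_mul_le_of_le ns ns')
  have n1 : ‖p' * d a + p a * d'‖ ≤ π * C + 1 * B :=
    norm_add_le_of_le (norm_mul_le_of_le np' nd) (norm_mul_le_of_le np nd')
  have n2 : ‖(p * d) a‖ ≤ 1 * C := norm_mul_le_of_le np nd
  have n3 : ‖(s' * s a + s a * s') * d a + (s * s) a * d'‖ ≤ (τ * σ + σ * τ) * C + σ * σ * B :=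
    norm_add_le_of_le (norm_mul_le_of_le nss' nd) (norm_mul_le_of_le nss nd')
  have n4 : ‖(s * s * d) a‖ ≤ σ * σ * C := norm_mul_le_of_le nss nd
  refine (norm_sub_le_of_le
    (norm_add_le_of_le (norm_mul_le_of_le n1 nss) (norm_mul_le_of_le n2 nss'))
    (norm_add_le_of_le (norm_mul_le_of_le n3 np) (norm_mul_le_of_le n4 np'))).trans_eq ?_
  ring

end Correction

/-! ### Heisenberg picture and the adiabatic estimate. -/

section Evolution

variable {𝔸 : Type*} [CStarAlgebra 𝔸] {T : ℝ} {h U : ℝ → 𝔸} {I : Set ℝ}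

/-- The equation of motion in the Heisenberg picture. -/
lemma hasDerivWithinAt_heisenberg {a : ℝ} {y : ℝ → 𝔸} {y' : 𝔸} (hh : IsSelfAdjoint (h a))
    (hU : HasDerivWithinAt U ((-(Complex.I * (T : ℂ))) • (h a * U a)) I a)
    (hy : HasDerivWithinAt y y' I a) :
    HasDerivWithinAt (fun s => star (U s) * y s * U s)
      (star (U a) * (y' + (Complex.I * (T : ℂ)) • (h a * y a - y a * h a)) * U a) I a := by
  refine ((hU.star.mul hy).mul hU).congr_deriv ?_
  simp only [star_smul, star_mul, hh.star_eq, star_neg, Complex.star_def, Complex.conj_I,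
    Complex.conj_ofReal, neg_neg, Pi.mul_apply, mul_neg, neg_smul, smul_mul_assoc,
    mul_smul_comm, mul_sub, sub_mul, mul_add, add_mul, smul_sub, mul_assoc,
    mul_comm (T : ℂ) Complex.I]
  abel

/-- The constant observable `1` commutes with `h`, so its Heisenberg evolution has zero derivative.
-/
lemma star_mul_self_eq_one (hI : Convex ℝ I) (h0 : (0 : ℝ) ∈ I)
    (hh : ∀ s ∈ I, IsSelfAdjoint (h s)) (hU0 : U 0 = 1)
    (hU : ∀ s ∈ I, HasDerivWithinAt U ((-(Complex.I * (T : ℂ))) • (h s * U s)) I s)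
    {s : ℝ} (hs : s ∈ I) : star (U s) * U s = 1 := by
  have hd : ∀ t ∈ I, HasDerivWithinAt (fun s => star (U s) * 1 * U s) 0 I t := fun t ht =>
    (hasDerivWithinAt_heisenberg (hh t ht) (hU t ht)
      (hasDerivWithinAt_const t I (1 : 𝔸))).congr_deriv (by simp)
  have := hI.norm_image_sub_le_of_norm_hasDerivWithin_le hd (C := 0) (by simp) h0 hs
  simpa [hU0, sub_eq_zero] using this

/-- The adiabatic theorem as a bound that is explicit in the second derivative of the
Hamiltonian. -/
theorem norm_one_sub_proj_mul_evolution_mul_proj_le [IsDedekindFiniteMonoid 𝔸]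
    {h' h'' p r : ℝ → 𝔸} {e : ℝ → ℂ} {c C B : ℝ} (hT : 0 < T)
    (hp : ∀ s ∈ Icc (0 : ℝ) 1, IsSpectralProjection (h s) (e s) (p s) (r s))
    (he : ContinuousOn e (Icc 0 1))
    (hh : ∀ s ∈ Icc (0 : ℝ) 1, IsSelfAdjoint (h s))
    (hh' : ∀ s ∈ Icc (0 : ℝ) 1, HasDerivWithinAt h (h' s) (Icc 0 1) s)
    (hh'' : ∀ s ∈ Icc (0 : ℝ) 1, HasDerivWithinAt h' (h'' s) (Icc 0 1) s)
    (hC : ∀ s ∈ Icc (0 : ℝ) 1, ‖h' s‖ ≤ C) (hB : ∀ s ∈ Icc (0 : ℝ) 1, ‖h'' s‖ ≤ B)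
    (hp0 : ∀ s ∈ Icc (0 : ℝ) 1, p s ≠ 0) (hpn : ∀ s ∈ Icc (0 : ℝ) 1, ‖p s‖ ≤ 1)
    (hrn : ∀ s ∈ Icc (0 : ℝ) 1, ‖r s‖ ≤ c) (hU0 : U 0 = 1)
    (hU : ∀ s ∈ Icc (0 : ℝ) 1,
      HasDerivWithinAt U ((-(Complex.I * (T : ℂ))) • (h s * U s)) (Icc 0 1) s) :
    ‖(1 - p 1) * U 1 * p 0‖ ≤
      (4 * (C * (c + 1) ^ 2) + 2 * (2 * (c + 1) * C * C * (c + 1) ^ 2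
        + 2 * C * (c * (2 * C + 2 * (c + 1) * C) * c + 2 * (c + 1) * C) * (c + 1))
        + 2 * (c + 1) ^ 2 * B) / T := by
  have m0 : (0 : ℝ) ∈ Icc (0 : ℝ) 1 := by simp
  have m1 : (1 : ℝ) ∈ Icc (0 : ℝ) 1 := by simp
  have hhc : ContinuousOn h (Icc 0 1) := fun s hs => (hh' s hs).continuousWithinAt
  have hpc := IsSpectralProjection.continuousOn_proj hp hhc he hpn hrn
  have hrc := IsSpectralProjection.continuousOn_inv hp hhc he hpc
  have hsn : ∀ s ∈ Icc (0 : ℝ) 1, ‖r s - p s‖ ≤ c + 1 := fun s hs =>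
    norm_sub_le_of_le (hrn s hs) (hpn s hs)
  set x : ℝ → 𝔸 := fun s => correction (p s) (r s - p s) (h' s) with hx
  have hxn : ∀ s ∈ Icc (0 : ℝ) 1, ‖x s‖ ≤ 2 * (C * (c + 1) ^ 2) := fun s hs =>
    norm_correction_le (hpn s hs) (hsn s hs) (hC s hs)
  have hpd : ∀ s ∈ Icc (0 : ℝ) 1, HasDerivWithinAt p (h s * x s - x s * h s) (Icc 0 1) s := by
    intro s hs
    obtain ⟨e', he', -⟩ := IsSpectralProjection.hasDerivWithinAt_eigenvalue hp hpc hs (hh' s hs)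
      (hp0 s hs) (hpn s hs)
    exact (IsSpectralProjection.hasDerivWithinAt_proj hp hpc hrc hs (hh' s hs) he').congr_deriv
      ((hp s hs).commutator_correction _).symm
  -- Here `2(c+1)C` bounds `p'`, and `c(2C + 2(c+1)C)c` bounds `r' = -r(h' - e' + p')r`, using `‖e'‖
  -- ≤ ‖h'‖ ≤ C`.
  have hxd : ∀ s ∈ Icc (0 : ℝ) 1, ∃ x' : 𝔸, HasDerivWithinAt x x' (Icc 0 1) s ∧
      ‖x'‖ ≤ 2 * (2 * (c + 1) * C * C * (c + 1) ^ 2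
        + 2 * C * (c * (2 * C + 2 * (c + 1) * C) * c + 2 * (c + 1) * C) * (c + 1))
        + 2 * (c + 1) ^ 2 * B := by
    intro s hs
    obtain ⟨e', he', hen⟩ := IsSpectralProjection.hasDerivWithinAt_eigenvalue hp hpc hs (hh' s hs)
      (hp0 s hs) (hpn s hs)
    have hp' := IsSpectralProjection.hasDerivWithinAt_proj hp hpc hrc hs (hh' s hs) he'
    have hr' := IsSpectralProjection.hasDerivWithinAt_inv hp hs (hh' s hs) he' hp'
    have np' : ‖-((r s - p s) * h' s * p s) - p s * h' s * (r s - p s)‖ ≤ 2 * (c + 1) * C := by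
      refine (norm_sub_le_of_le ((norm_neg _).trans_le
        (norm_mul₃_le_of_le (hsn s hs) (hC s hs) (hpn s hs)))
        (norm_mul₃_le_of_le (hpn s hs) (hC s hs) (hsn s hs))).trans_eq ?_
      ring
    have ne : ‖e' • (1 : 𝔸)‖ ≤ C := by
      rw [norm_smul]
      exact (mul_le_of_le_one_right (norm_nonneg _) norm_one_le).trans (hen.trans (hC s hs))
    have nr' := (norm_neg _).trans_le (norm_mul₃_le_of_le (hrn s hs)
      (norm_add_le_of_le (norm_sub_le_of_le (hC s hs) ne) np') (hrn s hs))
    refine exists_hasDerivWithinAt_correction hp' (hr'.sub hp') (hh'' s hs) (hpn s hs) (hsn s hs)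
      (hC s hs) np' ((norm_sub_le_of_le nr' np').trans_eq (by ring)) (hB s hs)
  set M := 2 * (2 * (c + 1) * C * C * (c + 1) ^ 2
        + 2 * C * (c * (2 * C + 2 * (c + 1) * C) * c + 2 * (c + 1) * C) * (c + 1))
        + 2 * (c + 1) ^ 2 * B with hM
  have unit1 : ∀ s ∈ Icc (0 : ℝ) 1, star (U s) * U s = 1 := fun s hs =>
    star_mul_self_eq_one (convex_Icc 0 1) m0 hh hU0 hU hs
  have Un : ∀ s ∈ Icc (0 : ℝ) 1, ‖U s‖ ≤ 1 := by
    intro s hs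
    have h1 : ‖U s‖ * ‖U s‖ ≤ 1 := by
      rw [← CStarRing.norm_star_mul_self, unit1 s hs]; exact norm_one_le
    nlinarith [norm_nonneg (U s)]
  have conj_le : ∀ s ∈ Icc (0 : ℝ) 1, ∀ y : 𝔸, ‖star (U s) * y * U s‖ ≤ ‖y‖ := by
    intro s hs y
    simpa using norm_mul₃_le_of_le ((norm_star (U s)).trans_le (Un s hs)) le_rfl (Un s hs)
  have nT : ‖Complex.I * (T : ℂ)⁻¹‖ = T⁻¹ := by simp [abs_of_pos hT]
  -- Since `iT · (i/T) = -1` and `p` commutes with `h`, the commutator `iT[h, y]` equals `-[h, x] =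
  -- -p'`.
  set y : ℝ → 𝔸 := fun s => p s + (Complex.I * (T : ℂ)⁻¹) • x s with hy
  choose! x' hx' hx'n using hxd
  have hTc : (T : ℂ) ≠ 0 := by exact_mod_cast hT.ne'
  have hyd : ∀ s ∈ Icc (0 : ℝ) 1, HasDerivWithinAt (fun s => star (U s) * y s * U s)
      (star (U s) * ((Complex.I * (T : ℂ)⁻¹) • x' s) * U s) (Icc 0 1) s := by
    intro s hs
    have h1 : HasDerivWithinAt y
        (h s * x s - x s * h s + (Complex.I * (T : ℂ)⁻¹) • x' s) (Icc 0 1) s :=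
      (hpd s hs).add ((hx' s hs).fun_const_smul _)
    refine (hasDerivWithinAt_heisenberg (hh s hs) (hU s hs) h1).congr_deriv ?_
    have h2 : h s * y s - y s * h s = (Complex.I * (T : ℂ)⁻¹) • (h s * x s - x s * h s) := by
      simp only [hy, mul_add, add_mul, (hp s hs).left, (hp s hs).right, mul_smul_comm,
        smul_mul_assoc, smul_sub]
      abel
    have h3 : Complex.I * (T : ℂ) * (Complex.I * (T : ℂ)⁻¹) = -1 := by
      rw [mul_mul_mul_comm, Complex.I_mul_I, mul_inv_cancel₀ hTc, mul_one]
    rw [h2, smul_smul, h3, neg_one_smul]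
    congr 2
    abel
  have main := (convex_Icc (0 : ℝ) 1).norm_image_sub_le_of_norm_hasDerivWithin_le hyd
    (C := T⁻¹ * M) (fun s hs => (conj_le s hs _).trans (by
      rw [norm_smul, nT]
      exact mul_le_mul_of_nonneg_left (hx'n s hs) (inv_nonneg.2 hT.le))) m0 m1
  have key : ‖p 0 - star (U 1) * p 1 * U 1‖ ≤ (4 * (C * (c + 1) ^ 2) + M) / T := by
    have e1 : p 0 - star (U 1) * p 1 * U 1
        = -(star (U 1) * y 1 * U 1 - star (U 0) * y 0 * U 0)
          + (star (U 1) * ((Complex.I * (T : ℂ)⁻¹) • x 1) * U 1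
            - (Complex.I * (T : ℂ)⁻¹) • x 0) := by
      simp only [hy, hU0, star_one, one_mul, mul_one, mul_add, add_mul]
      abel
    have small : ∀ s ∈ Icc (0 : ℝ) 1,
        ‖(Complex.I * (T : ℂ)⁻¹) • x s‖ ≤ T⁻¹ * (2 * (C * (c + 1) ^ 2)) := fun s hs => by
      rw [norm_smul, nT]
      exact mul_le_mul_of_nonneg_left (hxn s hs) (inv_nonneg.2 hT.le)
    rw [e1]
    refine (norm_add_le_of_le ((norm_neg _).trans_le main)
      (norm_sub_le_of_le ((conj_le 1 m1 _).trans (small 1 m1)) (small 0 m0))).trans_eq ?_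
    simp only [sub_zero, norm_one, div_eq_inv_mul]
    ring
  have e2 : (1 - p 1) * U 1 * p 0 = U 1 * (p 0 - star (U 1) * p 1 * U 1) * p 0 := by
    -- Dedekind finiteness turns the isometry `U 1` into a unitary.
    have hUU : U 1 * star (U 1) = 1 := mul_eq_one_symm (unit1 1 m1)
    have : U 1 * (p 0 - star (U 1) * p 1 * U 1) * p 0
        = U 1 * (p 0 * p 0) - (U 1 * star (U 1)) * p 1 * U 1 * p 0 := by noncomm_ring
    rw [this, hUU, (hp 0 m0).idem]
    noncomm_ring
  rw [e2, add_assoc]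
  calc _ ≤ 1 * ‖p 0 - star (U 1) * p 1 * U 1‖ * 1 :=
        norm_mul₃_le_of_le (Un 1 m1) le_rfl (hpn 0 m0)
    _ ≤ _ := by rw [one_mul, mul_one]; exact key

end Evolution


/-! ### Rank-one projectors. -/

section Projector

variable {N : ℕ}

lemma toEuclideanLin_proj (v w : State N) :
    Matrix.toEuclideanLin (proj v) w = inner ℂ v w • v := by
  ext i
  simp only [Matrix.toLpLin_apply, proj, Matrix.mulVec, dotProduct, Matrix.of_apply,
    PiLp.smul_apply, PiLp.inner_apply, RCLike.inner_apply, smul_eq_mul, Finset.sum_mul,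
    starRingEnd_apply]
  exact Finset.sum_congr rfl fun j _ => by ring

lemma isSelfAdjoint_proj (v : State N) : IsSelfAdjoint (proj v) := by
  ext i j
  simp [proj, Matrix.star_apply, mul_comm]

lemma ext_toEuclideanLin {A B : Mat N}
    (h : ∀ w, Matrix.toEuclideanLin A w = Matrix.toEuclideanLin B w) : A = B :=
  Matrix.toEuclideanLin.injective (LinearMap.ext h)

lemma toEuclideanLin_mul (A B : Mat N) (w : State N) :
    Matrix.toEuclideanLin (A * B) w = Matrix.toEuclideanLin A (Matrix.toEuclideanLin B w) := by
  simp [Matrix.toLpLin_apply]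

lemma norm_toEuclideanLin_le (A : Mat N) (w : State N) :
    ‖Matrix.toEuclideanLin A w‖ ≤ ‖A‖ * ‖w‖ :=
  Matrix.l2_opNorm_mulVec A w

lemma toEuclideanLin_proj_self {v : State N} (hv : ‖v‖ = 1) :
    Matrix.toEuclideanLin (proj v) v = v := by
  rw [toEuclideanLin_proj, inner_self_eq_norm_sq_to_K, hv]
  simp

lemma proj_mul_proj {v : State N} (hv : ‖v‖ = 1) : proj v * proj v = proj v :=
  ext_toEuclideanLin fun w => by
    rw [toEuclideanLin_mul, toEuclideanLin_proj v w, map_smul, toEuclideanLin_proj_self hv]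

lemma proj_ne_zero {v : State N} (hv : ‖v‖ = 1) : proj v ≠ 0 := by
  intro h
  have h1 := toEuclideanLin_proj_self hv
  rw [h, map_zero, LinearMap.zero_apply] at h1
  simp [← h1] at hv

lemma norm_proj_le_one {v : State N} (hv : ‖v‖ = 1) : ‖proj v‖ ≤ 1 := by
  have h1 := CStarRing.norm_star_mul_self (x := proj v)
  rw [(isSelfAdjoint_proj v).star_eq, proj_mul_proj hv] at h1
  exact (mul_right_cancel₀ (norm_ne_zero_iff.2 (proj_ne_zero hv)) (by rw [← h1, one_mul])).le

end Projector

/-! ### The gap bounds the resolvent. -/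

section Resolvent

variable {N : ℕ} {A : Mat N} {v : State N} {e : ℝ}

lemma mul_proj_of_eigenvector (hev : Matrix.toEuclideanLin A v = (e : ℂ) • v) :
    A * proj v = (e : ℂ) • proj v :=
  ext_toEuclideanLin fun w => by
    rw [toEuclideanLin_mul, map_smul, LinearMap.smul_apply, toEuclideanLin_proj, map_smul, hev,
      smul_comm]

lemma proj_mul_of_eigenvector (hA : A.IsHermitian)
    (hev : Matrix.toEuclideanLin A v = (e : ℂ) • v) : proj v * A = (e : ℂ) • proj v := by
  have h1 := congrArg star (mul_proj_of_eigenvector hev)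
  have h2 : star A = A := hA
  rwa [star_mul, star_smul, (isSelfAdjoint_proj v).star_eq, h2, Complex.star_def,
    Complex.conj_ofReal] at h1

/-- The eigenvalues of `A - e + |v⟩⟨v|` stay away from zero. -/
lemma le_enorm_of_mem_spectrum (hA : A.IsHermitian) (hv : ‖v‖ = 1)
    (hev : Matrix.toEuclideanLin A v = (e : ℂ) • v)
    (hfin : Module.finrank ℂ (Module.End.eigenspace (Matrix.toEuclideanLin A) (e : ℂ)) = 1)
    {g : ℝ≥0∞} (hg1 : g ≤ 1) (hg : g ≤ (spectrum ℂ A).einfsep)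
    {μ : ℂ} (hμ : μ ∈ spectrum ℂ (A - (e : ℂ) • (1 : Mat N) + proj v)) : g ≤ ‖μ‖ₑ := by
  rw [← Matrix.spectrum_toLpLin 2, ← Module.End.hasEigenvalue_iff_mem_spectrum] at hμ
  obtain ⟨w, hw⟩ := hμ.exists_hasEigenvector
  have hw0 := hw.2
  have hv0 : v ≠ 0 := by rintro rfl; simp at hv
  have eigen : Matrix.toEuclideanLin A w - (e : ℂ) • w + inner ℂ v w • v = μ • w := by
    have h1 : Matrix.toEuclideanLin (A - (e : ℂ) • (1 : Mat N) + proj v) w = μ • w :=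
      hw.apply_eq_smul
    have h2 : Matrix.toEuclideanLin (1 : Mat N) w = w := by simp
    rwa [map_add, map_sub, map_smul, LinearMap.add_apply, LinearMap.sub_apply,
      LinearMap.smul_apply, toEuclideanLin_proj, h2] at h1
  -- If `w ⟂ v`, then `w` is an eigenvector of `A` for `e + μ`, and `μ ≠ 0` because the eigenspace
  -- of `e` is the line through `v`; so `‖μ‖` is at least the gap. Otherwise pairing with `v` forces
  -- `μ = 1`.
  by_cases hvw : inner ℂ v w = 0
  · rw [hvw, zero_smul, add_zero, sub_eq_iff_eq_add, ← add_smul, add_comm] at eigen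
    have he : (e : ℂ) ∈ spectrum ℂ A := by
      rw [← Matrix.spectrum_toLpLin 2, ← Module.End.hasEigenvalue_iff_mem_spectrum]
      exact Module.End.hasEigenvalue_of_hasEigenvector
        ⟨Module.End.mem_eigenspace_iff.2 hev, hv0⟩
    have heμ : (e : ℂ) + μ ∈ spectrum ℂ A := by
      rw [← Matrix.spectrum_toLpLin 2, ← Module.End.hasEigenvalue_iff_mem_spectrum]
      exact Module.End.hasEigenvalue_of_hasEigenvector
        ⟨Module.End.mem_eigenspace_iff.2 eigen, hw0⟩
    have hμ0 : μ ≠ 0 := by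
      rintro rfl
      rw [add_zero] at eigen
      have hv' : (⟨v, Module.End.mem_eigenspace_iff.2 hev⟩ :
          Module.End.eigenspace (Matrix.toEuclideanLin A) (e : ℂ)) ≠ 0 := by
        simpa [Subtype.ext_iff] using hv0
      obtain ⟨c, hc⟩ := (finrank_eq_one_iff_of_nonzero' _ hv').1 hfin
        ⟨w, Module.End.mem_eigenspace_iff.2 eigen⟩
      have hcw : c • v = w := congrArg Subtype.val hc
      rw [← hcw, inner_smul_right, inner_self_eq_norm_sq_to_K, hv] at hvw
      have hc0 : c = 0 := by simpa using hvw
      exact hw0 (by rw [← hcw, hc0, zero_smul])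
    have h1 := einfsep_le_edist_of_mem heμ he (by simpa using hμ0)
    rw [edist_eq_enorm_sub, add_sub_cancel_left] at h1
    exact hg.trans h1
  · have hsym : inner ℂ v (Matrix.toEuclideanLin A w) = (e : ℂ) * inner ℂ v w := by
      rw [← Matrix.isSymmetric_toEuclideanLin_iff.2 hA v w, hev, inner_smul_left,
        Complex.conj_ofReal]
    have h1 := congrArg (inner ℂ v) eigen
    rw [inner_add_right, inner_sub_right, hsym, inner_smul_right, inner_smul_right,
      inner_smul_right, sub_self, zero_add, inner_self_eq_norm_sq_to_K, hv] at h1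
    have h2 : μ = 1 := by
      refine mul_right_cancel₀ hvw (h1.symm.trans ?_)
      simp
    simpa [h2] using hg1

lemma exists_isSpectralProjection_proj (hA : A.IsHermitian) (hv : ‖v‖ = 1)
    (hev : Matrix.toEuclideanLin A v = (e : ℂ) • v)
    (hfin : Module.finrank ℂ (Module.End.eigenspace (Matrix.toEuclideanLin A) (e : ℂ)) = 1)
    {c : ℝ≥0} (hc : 1 ≤ c) (hgap : (c : ℝ≥0∞)⁻¹ ≤ (spectrum ℂ A).einfsep) :
    ∃ r : Mat N, IsSpectralProjection A (e : ℂ) (proj v) r ∧ ‖r‖ ≤ c := by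
  have hspec : ∀ μ ∈ spectrum ℂ (A - (e : ℂ) • (1 : Mat N) + proj v), (c : ℝ≥0∞)⁻¹ ≤ ‖μ‖ₑ :=
    fun μ hμ => le_enorm_of_mem_spectrum hA hv hev hfin
      (ENNReal.inv_le_one.2 (by exact_mod_cast hc)) hgap hμ
  have hunit : IsUnit (A - (e : ℂ) • (1 : Mat N) + proj v) := by
    rw [← spectrum.zero_notMem_iff ℂ]
    intro h0
    simpa using hspec 0 h0
  obtain ⟨u, hu⟩ := hunit
  refine ⟨(↑u⁻¹ : Mat N), ⟨proj_mul_proj hv, mul_proj_of_eigenvector hev,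
    proj_mul_of_eigenvector hA hev, by rw [← hu, Units.inv_mul], by rw [← hu, Units.mul_inv]⟩, ?_⟩
  have hsa : IsSelfAdjoint (u : Mat N) := by
    have h1 : IsSelfAdjoint A := hA
    rw [hu]
    refine (h1.sub ?_).add (isSelfAdjoint_proj v)
    rw [IsSelfAdjoint, star_smul, star_one, Complex.star_def, Complex.conj_ofReal]
  have hsa' : IsSelfAdjoint (↑u⁻¹ : Mat N) := by
    have h1 : star u = u := Units.ext hsa
    rw [IsSelfAdjoint, ← Units.coe_star_inv, h1]
  -- The inverse is self-adjoint, so its norm is its spectral radius, the reciprocal of a distance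
  -- from zero already bounded below.
  have hrad : spectralRadius ℂ (↑u⁻¹ : Mat N) ≤ c := by
    refine iSup₂_le fun μ hμ => ?_
    rw [← spectrum.inv₀_mem_iff, hu] at hμ
    have h1 := hspec _ hμ
    rcases eq_or_ne μ 0 with rfl | hμ0
    · simp
    · rwa [enorm_inv hμ0, ENNReal.inv_le_inv] at h1
  rw [hsa'.spectralRadius_eq_nnnorm] at hrad
  exact_mod_cast hrad

end Resolvent

/-! ### Uniform error bound and the limit. -/

lemma norm_le_toReal_supNorm {N : ℕ} {A : ℝ → Mat N} (hA : supNorm A ≠ ∞) {s : ℝ}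
    (hs : s ∈ Icc (0 : ℝ) 1) : ‖A s‖ ≤ (supNorm A).toReal := by
  have h1 : ‖A s‖ₑ ≤ supNorm A := le_iSup₂ (f := fun s (_ : s ∈ Icc (0 : ℝ) 1) => ‖A s‖ₑ) s hs
  simpa using ENNReal.toReal_mono hA h1

/-- The constants are chosen before `T` and `H`: they depend only on the bounds `C` and `c`, which
makes the estimate uniform along the family. -/
lemma exists_adiabaticError_le {N : ℕ} (C : ℝ) {c : ℝ≥0} (hc : 1 ≤ c) :
    ∃ M₁ M₂ : ℝ, ∀ (T : ℝ) (H U : ℝ → Mat N) (E : ℝ → ℝ) (G : ℝ → State N) (B : ℝ), 0 < T →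
      (∀ s ∈ Icc (0 : ℝ) 1, (H s).IsHermitian) → TwiceDifferentiable H →
      IsNondegenerateEigenstate H E G → IsEvolution T H U →
      (∀ s ∈ Icc (0 : ℝ) 1, ‖dot H s‖ ≤ C) → (c : ℝ≥0∞)⁻¹ ≤ gapMin H →
      (∀ s ∈ Icc (0 : ℝ) 1, ‖dot (dot H) s‖ ≤ B) →
      adiabaticError G U ≤ (M₁ + M₂ * B) / T := by
  refine ⟨4 * (C * (c + 1) ^ 2) + 2 * (2 * (c + 1) * C * C * (c + 1) ^ 2
    + 2 * C * (c * (2 * C + 2 * (c + 1) * C) * c + 2 * (c + 1) * C) * (c + 1)),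
    2 * (c + 1) ^ 2, fun T H U E G B hT hH hD hG hU hC hgap hB => ?_⟩
  have hex : ∀ s ∈ Icc (0 : ℝ) 1, ∃ r : Mat N,
      IsSpectralProjection (H s) (E s : ℂ) (proj (G s)) r ∧ ‖r‖ ≤ c := fun s hs =>
    exists_isSpectralProjection_proj (hH s hs) (hG.norm_eq_one s hs) (hG.eigenvector s hs)
      (hG.nondegenerate s hs) hc (hgap.trans (iInf₂_le s hs))
  choose! r hr hrn using hex
  have m0 : (0 : ℝ) ∈ Icc (0 : ℝ) 1 := by simp
  have key := norm_one_sub_proj_mul_evolution_mul_proj_le hT hr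
    (Complex.continuous_ofReal.comp_continuousOn hG.continuousOn_energy) hH
    (fun s hs => (hD.1 s hs).hasDerivWithinAt) (fun s hs => (hD.2 s hs).hasDerivWithinAt) hC hB
    (fun s hs => proj_ne_zero (hG.norm_eq_one s hs))
    (fun s hs => norm_proj_le_one (hG.norm_eq_one s hs)) hrn hU.initial hU.schrodinger
  -- The vector `G 0` is a unit vector fixed by its own projector.
  have h1 : adiabaticError G U ≤ ‖(1 - proj (G 1)) * U 1 * proj (G 0)‖ := by
    have h2 := norm_toEuclideanLin_le ((1 - proj (G 1)) * U 1 * proj (G 0)) (G 0)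
    rwa [toEuclideanLin_mul, toEuclideanLin_proj_self (hG.norm_eq_one 0 m0),
      hG.norm_eq_one 0 m0, mul_one] at h2
  exact h1.trans key

end Adiabatic

theorem corollary2 {N : ℕ} (H U : ℝ → ℝ → Adiabatic.Mat N)
    (E : ℝ → ℝ → ℝ) (G : ℝ → ℝ → Adiabatic.State N)
    (hHerm : ∀ T > 0, ∀ s ∈ Icc (0 : ℝ) 1, (H T s).IsHermitian)
    (hDiff : ∀ T > 0, Adiabatic.TwiceDifferentiable (H T))
    (hG : ∀ T > 0, Adiabatic.IsNondegenerateEigenstate (H T) (E T) (G T))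
    (hU : ∀ T > 0, Adiabatic.IsEvolution T (H T) (U T))
    (hDot : ∃ C : ℝ≥0, ∀ T > 0, Adiabatic.supNorm (Adiabatic.dot (H T)) ≤ C)
    (hGap : ∃ C : ℝ≥0, ∀ T > 0, (Adiabatic.gapMin (H T))⁻¹ ≤ C)
    (hDdot : Tendsto
      (fun T : ℝ => Adiabatic.supNorm (Adiabatic.dot (Adiabatic.dot (H T))) / ENNReal.ofReal T)
      atTop (𝓝 0)) :
    Tendsto (fun T : ℝ => Adiabatic.adiabaticError (G T) (U T)) atTop (𝓝 0) := by
  obtain ⟨C, hC⟩ := hDot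
  obtain ⟨K, hK⟩ := hGap
  -- Taking `K + 1` rather than `K` secures `1 ≤ c`, needed because `h - e + p` has eigenvalue `1`
  -- on the level itself.
  obtain ⟨M₁, M₂, hM⟩ := Adiabatic.exists_adiabaticError_le (N := N) C (c := K + 1) (by simp)
  have hlim : Tendsto (fun T : ℝ => M₁ * T⁻¹ + M₂ *
      (Adiabatic.supNorm (Adiabatic.dot (Adiabatic.dot (H T))) / ENNReal.ofReal T).toReal)
      atTop (𝓝 0) := by
    have h1 := (ENNReal.tendsto_toReal ENNReal.zero_ne_top).comp hDdot
    have h2 := (tendsto_inv_atTop_zero.const_mul M₁).add (h1.const_mul M₂)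
    simpa using h2
  refine squeeze_zero' (Eventually.of_forall fun _ => norm_nonneg _) ?_ hlim
  filter_upwards [eventually_gt_atTop 0, hDdot.eventually_lt_const ENNReal.zero_lt_top]
    with T hT hfin
  -- Finiteness of the second-derivative bound holds only for large `T`, as a consequence of the
  -- limit.
  have hS : Adiabatic.supNorm (Adiabatic.dot (Adiabatic.dot (H T))) ≠ ∞ := by
    intro h
    simp [h, ENNReal.top_div] at hfin
  have hS' : Adiabatic.supNorm (Adiabatic.dot (H T)) ≠ ∞ :=
    ((hC T hT).trans_lt ENNReal.coe_lt_top).ne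
  refine (hM T (H T) (U T) (E T) (G T) _ hT (hHerm T hT) (hDiff T hT) (hG T hT) (hU T hT)
    (fun s hs => (Adiabatic.norm_le_toReal_supNorm hS' hs).trans ?_) ?_
    (fun s hs => Adiabatic.norm_le_toReal_supNorm hS hs)).trans_eq ?_
  · simpa using ENNReal.toReal_mono ENNReal.coe_ne_top (hC T hT)
  · rw [ENNReal.inv_le_iff_inv_le]
    exact (hK T hT).trans (by simp)
  · rw [ENNReal.toReal_div, ENNReal.toReal_ofReal hT.le]
    ring
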